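/- Let $X$ and $Y$ be Banach spaces over the same field $\mathbb{K}\in\{\mathbb{R},\mathbb{C}\}$, and let $\mathcal{L}(X,Y)$ denote the set of bounded linear operators from $X$ to $Y$. An operator $T\in\mathcal{L}(X,Y)$ is upper semi-Fredholm if its kernel is finite-dimensional and its range is closed; it is strictly singular if there is no closed infinite-dimensional subspace $M$ of $X$ such that the restriction $T|_M$ is an isomorphism onto its image. Let $\Phi_+(X,Y)$ and $\mathcal{SS}(X,Y)$ be the sets of upper semi-Fredholm and of strictly singular operators from $X$ to $Y$, and let $$P\Phi_+(X,Y)=\{K\in\mathcal{L}(X,Y) : T+K\in\Phi_+(X,Y)\text{ for every }T\in\Phi_+(X,Y)\}.$$ The space $X$ is subprojective if every closed infinite-dimensional subspace of $X$ contains an infinite-dimensional subspace that is complemented in $X$ (i.e. is the range of a bounded linear projection on $X$). Suppose that $\Phi_+(X,Y)$ is not empty and that $X$ is subprojective. Then $P\Phi_+(X,Y)=\mathcal{SS}(X,Y)$. -/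

import Mathlib

section Operators

variable {𝕜 : Type*} [RCLike 𝕜]
  {X : Type*} [NormedAddCommGroup X] [NormedSpace 𝕜 X]
  {Y : Type*} [NormedAddCommGroup Y] [NormedSpace 𝕜 Y]

/-- An operator is upper semi-Fredholm if its kernel is finite-dimensional and its range is
closed. -/
def IsUpperSemiFredholm (T : X →L[𝕜] Y) : Prop :=
  FiniteDimensional 𝕜 T.ker ∧ IsClosed (T.range : Set Y)

/-- An operator is strictly singular if its restriction to a closed infinite-dimensional subspace
is never an isomorphism (onto its image). -/
def IsStrictlySingular (T : X →L[𝕜] Y) : Prop :=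
  ∀ M : Submodule 𝕜 X, IsClosed (M : Set X) → ¬ FiniteDimensional 𝕜 M →
    ¬ Topology.IsEmbedding (T ∘L M.subtypeL)

/-- The perturbation class of a set `A` of operators from `X` to `Y`. -/
def perturbationClass (A : Set (X →L[𝕜] Y)) : Set (X →L[𝕜] Y) :=
  {K | ∀ T ∈ A, T + K ∈ A}

variable (𝕜 X Y)

/-- The set `Φ₊(X, Y)` of upper semi-Fredholm operators from `X` to `Y`. -/
def upperSemiFredholm : Set (X →L[𝕜] Y) :=
  {T | IsUpperSemiFredholm T}

/-- The set `SS(X, Y)` of strictly singular operators from `X` to `Y`. -/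
def strictlySingular : Set (X →L[𝕜] Y) :=
  {T | IsStrictlySingular T}

/-- A space is subprojective if every closed infinite-dimensional subspace contains an
infinite-dimensional subspace that is complemented in the whole space (that is, it is the range of
a continuous projection; in particular it is closed). -/
def IsSubprojective : Prop :=
  ∀ M : Submodule 𝕜 X, IsClosed (M : Set X) → ¬ FiniteDimensional 𝕜 M →
    ∃ N : Submodule 𝕜 X, N ≤ M ∧ ¬ FiniteDimensional 𝕜 N ∧ N.ClosedComplemented

end Operators

/-!
An operator between Banach spaces is upper semi-Fredholm exactly when no restriction to a closed
infinite-dimensional subspace is compact. If `T` is not upper semi-Fredholm, then every closed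
subspace of finite codimension has unit vectors at which `T` is arbitrarily small; with dual
functionals vanishing on the earlier vectors, this yields a biorthogonal sequence
`(xₙ, fₙ)` with `∑ ‖fₙ‖ ‖T xₙ‖ < ∞`, and `T` agrees with the compact operator `∑ fₙ ⊗ T xₙ` at each
`xₙ`. Consequently a strictly singular operator is compact on some closed infinite-dimensional
subspace, and `SS ⊆ PΦ₊` follows.

Conversely, `PΦ₊` is stable under composition with operators on the domain, since each of these is
a sum of two invertible ones. Let `K ∈ PΦ₊` be an isomorphism on the range `N` of a projection `P`
of infinite rank, let `S ∈ Φ₊`, and put `T = K P + S (1 - P)`. As `T` and `K P` agree on `N`, the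
operator `T` is compact on some infinite-dimensional `L`. There `1 - P` has to be strictly singular:
if it were an isomorphism on a subspace of `L`, then composing with its inverse and a projection `q`
given by subprojectivity would exhibit `S q` as an element of `PΦ₊`. So `1 - P` is compact on a
smaller subspace, hence so are `K P`, `P` and finally the inclusion, which is absurd.
-/

open Filter Topology

section ClosedEmbedding

theorem isClosedEmbedding_of_isEmbedding {𝕜 : Type*} [NontriviallyNormedField 𝕜]
    {X : Type*} [NormedAddCommGroup X] [NormedSpace 𝕜 X] [CompleteSpace X]
    {Y : Type*} [NormedAddCommGroup Y] [NormedSpace 𝕜 Y] {T : X →L[𝕜] Y} (hT : IsEmbedding T) :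
    IsClosedEmbedding T :=
  (AddMonoidHom.isUniformEmbedding_of_isEmbedding hT).isClosedEmbedding

end ClosedEmbedding

section CompactOperator

theorem isCompactOperator_prodMk {X Y Z : Type*} [Zero X] [TopologicalSpace X]
    [TopologicalSpace Y] [TopologicalSpace Z] {f : X → Y} {g : X → Z}
    (hf : IsCompactOperator f) (hg : IsCompactOperator g) :
    IsCompactOperator fun x => (f x, g x) := by
  obtain ⟨A, hA, hfA⟩ := hf
  obtain ⟨B, hB, hgB⟩ := hg
  exact ⟨A ×ˢ B, hA.prod hB, inter_mem hfA hgB⟩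

theorem isCompactOperator_of_isClosedEmbedding_comp {X Y Z : Type*} [Zero X] [TopologicalSpace X]
    [TopologicalSpace Y] [TopologicalSpace Z] {f : X → Y} {j : Y → Z} (hj : IsClosedEmbedding j)
    (h : IsCompactOperator (j ∘ f)) : IsCompactOperator f := by
  obtain ⟨A, hA, hmem⟩ := h
  exact ⟨j ⁻¹' A, hj.isCompact_preimage hA, hmem⟩

variable {𝕜 : Type*} [NontriviallyNormedField 𝕜]
  {X : Type*} [NormedAddCommGroup X] [NormedSpace 𝕜 X]
  {Y : Type*} [NormedAddCommGroup Y] [NormedSpace 𝕜 Y]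
  {Z : Type*} [NormedAddCommGroup Z] [NormedSpace 𝕜 Z]
  {E : Type*} [NormedAddCommGroup E] [NormedSpace 𝕜 E]

theorem isCompactOperator_tsum_smulRight [LocallyCompactSpace 𝕜] [CompleteSpace Y] {ι : Type*}
    {f : ι → X →L[𝕜] 𝕜} {y : ι → Y} (h : Summable fun i => (f i).smulRight (y i)) :
    IsCompactOperator ⇑(∑' i, (f i).smulRight (y i) : X →L[𝕜] Y) := by
  refine isCompactOperator_of_tendsto h.hasSum (Eventually.of_forall fun s => ?_)
  refine (compactOperator (RingHom.id 𝕜) X Y).sum_mem fun i _ => ?_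
  exact (isCompactOperator_of_locallyCompactSpace_dom (f i)).clm_comp
    (ContinuousLinearMap.toSpanSingleton 𝕜 (y i))

theorem finiteDimensional_of_isCompactOperator_of_isClosedEmbedding [CompleteSpace 𝕜]
    {T : X →L[𝕜] Y} (hT : IsCompactOperator T) (hemb : IsClosedEmbedding T) :
    FiniteDimensional 𝕜 X :=
  .of_isCompactOperator_id (isCompactOperator_of_isClosedEmbedding_comp hemb hT)

theorem finiteDimensional_of_isCompactOperator_comp_of_isCompactOperator_id_sub_comp
    [CompleteSpace 𝕜] {K : X →L[𝕜] Y} {j : Z →L[𝕜] X} {p : X →L[𝕜] Z} {ι : E →L[𝕜] X}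
    (hKj : IsClosedEmbedding (K ∘L j)) (hι : IsClosedEmbedding ι)
    (hK : IsCompactOperator (K ∘L (j ∘L p) ∘L ι))
    (hsub : IsCompactOperator ((.id 𝕜 X - j ∘L p : X →L[𝕜] X) ∘L ι)) : FiniteDimensional 𝕜 E := by
  have hp : IsCompactOperator (p ∘L ι) := isCompactOperator_of_isClosedEmbedding_comp hKj hK
  have hι_eq : ι = j ∘L (p ∘L ι) + (.id 𝕜 X - j ∘L p : X →L[𝕜] X) ∘L ι := by
    ext x
    simp
  have hι_compact : IsCompactOperator ι := hι_eq ▸ (hp.clm_comp j).add hsub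
  exact finiteDimensional_of_isCompactOperator_of_isClosedEmbedding hι_compact hι

end CompactOperator

section UpperSemiFredholm

variable {𝕜 : Type*} [RCLike 𝕜]
  {X : Type*} [NormedAddCommGroup X] [NormedSpace 𝕜 X]
  {Y : Type*} [NormedAddCommGroup Y] [NormedSpace 𝕜 Y]
  {Z : Type*} [NormedAddCommGroup Z] [NormedSpace 𝕜 Z]

theorem exists_norm_eq_one_of_not_isClosedEmbedding [CompleteSpace X] {T : X →L[𝕜] Y}
    (hT : ¬ IsClosedEmbedding T) {ε : ℝ} (hε : 0 < ε) : ∃ x, ‖x‖ = 1 ∧ ‖T x‖ < ε := by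
  by_contra! h
  have hanti : AntilipschitzWith ε.toNNReal⁻¹ T := by
    refine antilipschitz_of_bound_of_norm_one (𝕜 := 𝕜) T fun x hx => ?_
    rw [NNReal.coe_inv, Real.coe_toNNReal ε hε.le, inv_mul_eq_div, one_le_div hε]
    exact h x hx
  exact hT (hanti.isClosedEmbedding T.uniformContinuous)

theorem IsUpperSemiFredholm.of_isClosedEmbedding_comp_ker {T : X →L[𝕜] Y} (φ : X →L[𝕜] Z)
    [FiniteDimensional 𝕜 Z] (h : IsClosedEmbedding (T ∘L φ.ker.subtypeL)) :
    IsUpperSemiFredholm T := by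
  have hcofg : φ.ker.CoFG := .ker φ.toLinearMap
  constructor
  · refine .of_fg (hcofg.fg_of_disjoint (Submodule.disjoint_def.2 fun x hT hφ => ?_))
    have hx : (⟨x, hφ⟩ : φ.ker) = 0 := h.injective (hT.trans (map_zero _).symm)
    exact congrArg Subtype.val hx
  · refine LinearMap.isClosed_range_of_isClosed_map_of_finiteDimensional_quotient
      (f := T.toLinearMap) (s := φ.ker) ?_
    convert h.isClosed_range using 1
    ext y
    simp

theorem IsUpperSemiFredholm.isClosedEmbedding_prod [CompleteSpace X] [CompleteSpace Y]
    {T : X →L[𝕜] Y} (hT : IsUpperSemiFredholm T) {p : X →L[𝕜] T.ker} (hp : ∀ x : T.ker, p x = x) :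
    IsClosedEmbedding (T.prod p) := by
  have hTp (x : X) : T (p x) = 0 := (p x).2
  have : CompleteSpace T.ker := T.isClosed_ker.completeSpace_coe
  have hinj : Function.Injective (T.prod p) := by
    refine (injective_iff_map_eq_zero _).2 fun x hx => ?_
    obtain ⟨hTx, hpx⟩ := Prod.mk.inj hx
    exact congrArg Subtype.val ((hp ⟨x, hTx⟩).symm.trans hpx)
  have hrange : Set.range (T.prod p) = Set.range T ×ˢ Set.univ := by
    refine Set.Subset.antisymm (by rintro _ ⟨x, rfl⟩; simp) ?_
    rintro ⟨_, z⟩ ⟨⟨x, rfl⟩, -⟩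
    exact ⟨x - p x + z, by simp [hTp, hp]⟩
  obtain ⟨c, hc⟩ := (T.prod p).antilipschitz_of_injective_of_isClosed_range hinj
    (hrange ▸ hT.2.prod isClosed_univ)
  exact hc.isClosedEmbedding (T.prod p).uniformContinuous

theorem IsUpperSemiFredholm.finiteDimensional_of_isCompactOperator_comp [CompleteSpace X]
    [CompleteSpace Y] {T : X →L[𝕜] Y} (hT : IsUpperSemiFredholm T) {J : Z →L[𝕜] X}
    (hJ : IsClosedEmbedding J) (h : IsCompactOperator (T ∘L J)) : FiniteDimensional 𝕜 Z := by
  have := hT.1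
  have : LocallyCompactSpace T.ker := .of_finiteDimensional_of_complete 𝕜 _
  obtain ⟨p, hp⟩ := Submodule.ClosedComplemented.of_finiteDimensional T.ker
  have hcompact : IsCompactOperator (T.prod p ∘L J) :=
    isCompactOperator_prodMk h ((isCompactOperator_of_locallyCompactSpace_dom p).comp_clm J)
  exact finiteDimensional_of_isCompactOperator_of_isClosedEmbedding hcompact
    ((hT.isClosedEmbedding_prod hp).comp hJ)

theorem IsUpperSemiFredholm.exists_isClosedEmbedding_comp_subtypeL [CompleteSpace X]
    [CompleteSpace Y] {T : X →L[𝕜] Y} (hT : IsUpperSemiFredholm T) :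
    ∃ W : Submodule 𝕜 X, IsClosed (W : Set X) ∧ W.CoFG ∧ IsClosedEmbedding (T ∘L W.subtypeL) := by
  have := hT.1
  obtain ⟨p, hp⟩ := Submodule.ClosedComplemented.of_finiteDimensional T.ker
  have : CompleteSpace p.ker := p.isClosed_ker.completeSpace_coe
  have hcomp : (fun y => (y, (0 : T.ker))) ∘ (T ∘L p.ker.subtypeL) = T.prod p ∘ p.ker.subtypeL :=
    funext fun x => Prod.ext rfl x.2.symm
  have hemb : IsEmbedding (T.prod p ∘ p.ker.subtypeL) :=
    (hT.isClosedEmbedding_prod hp).isEmbedding.comp .subtypeVal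
  refine ⟨p.ker, p.isClosed_ker, .ker p.toLinearMap, isClosedEmbedding_of_isEmbedding ?_⟩
  exact .of_comp (map_continuous _) (by fun_prop) (hcomp ▸ hemb)

theorem exists_dual_of_not_isUpperSemiFredholm [CompleteSpace X] {T : X →L[𝕜] Y}
    (hT : ¬ IsUpperSemiFredholm T) (F : Submodule 𝕜 X) [FiniteDimensional 𝕜 F] (φ : X →L[𝕜] Z)
    [FiniteDimensional 𝕜 Z] {ε : ℝ} (hε : 0 < ε) :
    ∃ (x : X) (f : X →L[𝕜] 𝕜), φ x = 0 ∧ (∀ y ∈ F, f y = 0) ∧ f x = 1 ∧ ‖f‖ * ‖T x‖ ≤ ε := by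
  obtain ⟨p, hp⟩ := Submodule.ClosedComplemented.of_finiteDimensional F
  let R : X →L[𝕜] X := .id 𝕜 X - F.subtypeL ∘L p
  have hker : ¬ IsClosedEmbedding (T ∘L (φ.prod p).ker.subtypeL) :=
    fun h => hT (.of_isClosedEmbedding_comp_ker _ h)
  have : CompleteSpace (φ.prod p).ker := (φ.prod p).isClosed_ker.completeSpace_coe
  obtain ⟨⟨x, hx⟩, hx1, hTx⟩ :=
    exists_norm_eq_one_of_not_isClosedEmbedding hker (ε := ε / (‖R‖ + 1)) (by positivity)
  obtain ⟨hφx, hpx⟩ : φ x = 0 ∧ p x = 0 := Prod.mk.inj hx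
  replace hx1 : ‖x‖ = 1 := hx1
  obtain ⟨g, hg, hgx⟩ := exists_dual_vector 𝕜 x (by simp [hx1])
  refine ⟨x, g ∘L R, hφx, fun y hy => ?_, ?_, ?_⟩
  · simp [R, hp ⟨y, hy⟩]
  · simp [R, hpx, hgx, hx1]
  · calc ‖g ∘L R‖ * ‖T x‖ ≤ ‖R‖ * (ε / (‖R‖ + 1)) := by
          gcongr
          · simpa [hg] using g.opNorm_comp_le R
          · exact hTx.le
      _ ≤ ε := by
          rw [mul_div_left_comm]
          exact mul_le_of_le_one_right hε.le (div_le_one_of_le₀ (by linarith) (by positivity))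

theorem exists_biorthogonal_of_not_isUpperSemiFredholm [CompleteSpace X] {T : X →L[𝕜] Y}
    (hT : ¬ IsUpperSemiFredholm T) :
    ∃ (x : ℕ → X) (f : ℕ → X →L[𝕜] 𝕜), (∀ n, f n (x n) = 1) ∧
      (Pairwise fun m n => f m (x n) = 0) ∧ Summable fun n => ‖f n‖ * ‖T (x n)‖ := by
  classical
  -- A triple `(n, x, f)` carries the exponent of its bound `2⁻ⁿ`; that exponent has to increase
  -- along the sequence for the sum to converge.
  have hstep (s : Finset (ℕ × X × (X →L[𝕜] 𝕜))) : ∃ b : ℕ × X × (X →L[𝕜] 𝕜),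
      (b.2.2 b.2.1 = 1 ∧ ‖b.2.2‖ * ‖T b.2.1‖ ≤ (1 / 2) ^ b.1) ∧
        ∀ a ∈ s, a.1 < b.1 ∧ a.2.2 b.2.1 = 0 ∧ b.2.2 a.2.1 = 0 := by
    obtain ⟨n, hn⟩ := (s.image Prod.fst).exists_nat_subset_range
    obtain ⟨x, f, hφx, hfF, hfx, hle⟩ := exists_dual_of_not_isUpperSemiFredholm hT
      (Submodule.span 𝕜 (s.image fun a => a.2.1)) (ContinuousLinearMap.pi fun a : s => a.1.2.2)
      (ε := (1 / 2) ^ n) (by positivity)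
    refine ⟨(n, x, f), ⟨hfx, hle⟩, fun a ha => ⟨?_, congrFun hφx ⟨a, ha⟩, ?_⟩⟩
    · exact Finset.mem_range.1 (hn (Finset.mem_image_of_mem _ ha))
    · exact hfF _ (Submodule.subset_span (Finset.mem_image_of_mem _ ha))
  obtain ⟨b, hb, hlt⟩ := exists_seq_of_forall_finset_exists _ _ fun s _ => hstep s
  have hmono : StrictMono fun n => (b n).1 := fun m n hmn => (hlt m n hmn).1
  refine ⟨fun n => (b n).2.1, fun n => (b n).2.2, fun n => (hb n).1, fun m n hmn => ?_, ?_⟩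
  · rcases hmn.lt_or_gt with hmn | hmn
    · exact (hlt m n hmn).2.1
    · exact (hlt n m hmn).2.2
  · exact .of_nonneg_of_le (fun n => by positivity) (fun n => (hb n).2)
      (summable_geometric_two.comp_injective hmono.injective)

theorem exists_isCompactOperator_of_not_isUpperSemiFredholm [CompleteSpace X] [CompleteSpace Y]
    {T : X →L[𝕜] Y} (hT : ¬ IsUpperSemiFredholm T) :
    ∃ C : X →L[𝕜] Y, IsCompactOperator C ∧ ¬ FiniteDimensional 𝕜 (T - C).ker := by
  obtain ⟨x, f, hone, hzero, hsum⟩ := exists_biorthogonal_of_not_isUpperSemiFredholm hT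
  have hsummable : Summable fun n => (f n).smulRight (T (x n)) :=
    .of_norm (by simpa only [ContinuousLinearMap.norm_smulRight_apply] using hsum)
  let C : X →L[𝕜] Y := ∑' n, (f n).smulRight (T (x n))
  have hCx (n : ℕ) : C (x n) = T (x n) := by
    have hsingle := hasSum_single (f := fun m => f m (x n) • T (x m)) n fun m hmn => by
      rw [hzero hmn, zero_smul]
    rw [hone, one_smul] at hsingle
    exact (hsummable.hasSum.mapL (ContinuousLinearMap.apply 𝕜 Y (x n))).unique hsingle
  refine ⟨C, isCompactOperator_tsum_smulRight hsummable, fun hfin => ?_⟩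
  let v (n : ℕ) : (T - C).ker := ⟨x n, sub_eq_zero.2 (hCx n).symm⟩
  have hv : LinearIndependent 𝕜 v := .of_pairwise_dual_eq_zero_one v
    (fun n => (f n).toLinearMap ∘ₗ (T - C).ker.subtype) hzero hone
  exact not_finite_iff_infinite.2 inferInstance hv.finite

theorem exists_isCompactOperator_comp_subtypeL_of_not_isUpperSemiFredholm [CompleteSpace X]
    [CompleteSpace Y] {T : X →L[𝕜] Y} (hT : ¬ IsUpperSemiFredholm T) :
    ∃ M : Submodule 𝕜 X, IsClosed (M : Set X) ∧ ¬ FiniteDimensional 𝕜 M ∧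
      IsCompactOperator (T ∘L M.subtypeL) := by
  obtain ⟨C, hC, hinf⟩ := exists_isCompactOperator_of_not_isUpperSemiFredholm hT
  refine ⟨(T - C).ker, (T - C).isClosed_ker, hinf, ?_⟩
  have hTC : T ∘L (T - C).ker.subtypeL = C ∘L (T - C).ker.subtypeL :=
    ContinuousLinearMap.ext fun x => sub_eq_zero.1 x.2
  exact hTC ▸ hC.comp_clm _

end UpperSemiFredholm

section StrictlySingular

variable {𝕜 : Type*} [RCLike 𝕜]
  {X : Type*} [NormedAddCommGroup X] [NormedSpace 𝕜 X]
  {Y : Type*} [NormedAddCommGroup Y] [NormedSpace 𝕜 Y]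
  {Z : Type*} [NormedAddCommGroup Z] [NormedSpace 𝕜 Z]

theorem IsStrictlySingular.comp [CompleteSpace Z] {K : X →L[𝕜] Y} (hK : IsStrictlySingular K)
    (J : Z →L[𝕜] X) : IsStrictlySingular (K ∘L J) := by
  intro M hM hinf hemb
  have : CompleteSpace M := hM.completeSpace_coe
  let j : M →L[𝕜] X := J ∘L M.subtypeL
  have hj : IsClosedEmbedding j :=
    isClosedEmbedding_of_isEmbedding (.of_comp j.continuous K.continuous hemb)
  refine hK j.range hj.isClosed_range (fun hfin => hinf ?_) ?_
  · exact (LinearEquiv.ofInjective j.toLinearMap hj.injective).symm.finiteDimensional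
  · let e : M ≃ₜ j.range := hj.isEmbedding.toHomeomorph
    have hcomp : K ∘L j.range.subtypeL = (K ∘L j) ∘ e.symm :=
      funext fun y => congrArg (K ∘ Subtype.val) (e.apply_symm_apply y).symm
    exact hcomp ▸ hemb.comp e.symm.isEmbedding

theorem isStrictlySingular_of_isCompactOperator [CompleteSpace X] {K : X →L[𝕜] Y}
    (hK : IsCompactOperator K) : IsStrictlySingular K := by
  intro M hM hinf hemb
  have : CompleteSpace M := hM.completeSpace_coe
  exact hinf (finiteDimensional_of_isCompactOperator_of_isClosedEmbedding
    (hK.comp_clm M.subtypeL) (isClosedEmbedding_of_isEmbedding hemb))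

variable [CompleteSpace X] [CompleteSpace Y]

theorem IsStrictlySingular.exists_isCompactOperator_comp_subtypeL {K : X →L[𝕜] Y}
    (hK : IsStrictlySingular K) (hX : ¬ FiniteDimensional 𝕜 X) :
    ∃ M : Submodule 𝕜 X, IsClosed (M : Set X) ∧ ¬ FiniteDimensional 𝕜 M ∧
      IsCompactOperator (K ∘L M.subtypeL) := by
  refine exists_isCompactOperator_comp_subtypeL_of_not_isUpperSemiFredholm fun hFred => ?_
  obtain ⟨W, hW, hcofg, hemb⟩ := hFred.exists_isClosedEmbedding_comp_subtypeL
  refine hK W hW (fun hfin => hX ?_) hemb.isEmbedding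
  have : Module.Finite 𝕜 (X ⧸ W) := hcofg
  exact Module.Finite.of_submodule_quotient W

theorem IsUpperSemiFredholm.add_isStrictlySingular {T K : X →L[𝕜] Y} (hT : IsUpperSemiFredholm T)
    (hK : IsStrictlySingular K) : IsUpperSemiFredholm (T + K) := by
  by_contra hTK
  obtain ⟨M, hM, hMinf, hTKM⟩ :=
    exists_isCompactOperator_comp_subtypeL_of_not_isUpperSemiFredholm hTK
  have : CompleteSpace M := hM.completeSpace_coe
  obtain ⟨N, hN, hNinf, hKN⟩ := (hK.comp M.subtypeL).exists_isCompactOperator_comp_subtypeL hMinf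
  have hJ : IsClosedEmbedding (M.subtypeL ∘L N.subtypeL) :=
    hM.isClosedEmbedding_subtypeVal.comp hN.isClosedEmbedding_subtypeVal
  have hsub : T ∘L (M.subtypeL ∘L N.subtypeL) =
      ((T + K) ∘L M.subtypeL) ∘L N.subtypeL - (K ∘L M.subtypeL) ∘L N.subtypeL := by
    ext x
    simp
  refine hNinf (hT.finiteDimensional_of_isCompactOperator_comp hJ ?_)
  exact hsub ▸ (hTKM.comp_clm N.subtypeL).sub hKN

theorem strictlySingular_subset_perturbationClass :
    strictlySingular 𝕜 X Y ⊆ perturbationClass (upperSemiFredholm 𝕜 X Y) :=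
  fun _ hK _ hT => IsUpperSemiFredholm.add_isStrictlySingular hT hK

end StrictlySingular

section PerturbationClass

theorem exists_isUnit_add_isUnit_eq {𝕜 A : Type*} [NontriviallyNormedField 𝕜] [NormedRing A]
    [NormedAlgebra 𝕜 A] [CompleteSpace A] (a : A) :
    ∃ u v : A, IsUnit u ∧ IsUnit v ∧ u + v = a := by
  obtain ⟨k, hk⟩ := NormedField.exists_lt_norm 𝕜 (‖a‖ * ‖(1 : A)‖)
  have hk0 : k ≠ 0 := norm_pos_iff.1 (hk.trans_le' (by positivity))
  have hres : IsUnit (algebraMap 𝕜 A k - a) := spectrum.mem_resolventSet_of_norm_lt_mul hk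
  exact ⟨algebraMap 𝕜 A k, -(algebraMap 𝕜 A k - a), hk0.isUnit.map _, hres.neg, by abel⟩

variable {𝕜 : Type*} [RCLike 𝕜]
  {X : Type*} [NormedAddCommGroup X] [NormedSpace 𝕜 X]
  {Y : Type*} [NormedAddCommGroup Y] [NormedSpace 𝕜 Y]
  {Z : Type*} [NormedAddCommGroup Z] [NormedSpace 𝕜 Z]

theorem add_mem_perturbationClass {s : Set (X →L[𝕜] Y)} {K L : X →L[𝕜] Y}
    (hK : K ∈ perturbationClass s) (hL : L ∈ perturbationClass s) :
    K + L ∈ perturbationClass s :=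
  fun T hT => add_assoc T K L ▸ hL _ (hK T hT)

theorem IsUpperSemiFredholm.comp_equiv {T : X →L[𝕜] Y} (hT : IsUpperSemiFredholm T)
    (e : Z ≃L[𝕜] X) : IsUpperSemiFredholm (T ∘L (e : Z →L[𝕜] X)) := by
  have := hT.1
  constructor
  · exact (e.toLinearEquiv.ofSubmodule' T.ker).symm.finiteDimensional
  · convert hT.2 using 2
    exact LinearMap.range_comp_of_range_eq_top _ e.toLinearEquiv.range

theorem comp_equiv_mem_perturbationClass {K : X →L[𝕜] Y}
    (hK : K ∈ perturbationClass (upperSemiFredholm 𝕜 X Y)) (e : Z ≃L[𝕜] X) :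
    K ∘L (e : Z →L[𝕜] X) ∈ perturbationClass (upperSemiFredholm 𝕜 Z Y) := by
  intro T hT
  have hsum : T + K ∘L (e : Z →L[𝕜] X) =
      (T ∘L (e.symm : X →L[𝕜] Z) + K) ∘L (e : Z →L[𝕜] X) := by
    ext x
    simp
  rw [hsum]
  exact IsUpperSemiFredholm.comp_equiv (hK _ (IsUpperSemiFredholm.comp_equiv hT e.symm)) e

theorem comp_mem_perturbationClass [CompleteSpace X] {K : X →L[𝕜] Y}
    (hK : K ∈ perturbationClass (upperSemiFredholm 𝕜 X Y)) (A : X →L[𝕜] X) :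
    K ∘L A ∈ perturbationClass (upperSemiFredholm 𝕜 X Y) := by
  obtain ⟨_, _, ⟨u, rfl⟩, ⟨v, rfl⟩, rfl⟩ := exists_isUnit_add_isUnit_eq (𝕜 := 𝕜) A
  rw [ContinuousLinearMap.comp_add]
  exact add_mem_perturbationClass
    (comp_equiv_mem_perturbationClass hK (ContinuousLinearEquiv.unitsEquiv 𝕜 X u))
    (comp_equiv_mem_perturbationClass hK (ContinuousLinearEquiv.unitsEquiv 𝕜 X v))

theorem neg_mem_perturbationClass {K : X →L[𝕜] Y}
    (hK : K ∈ perturbationClass (upperSemiFredholm 𝕜 X Y)) :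
    -K ∈ perturbationClass (upperSemiFredholm 𝕜 X Y) := by
  have h := comp_equiv_mem_perturbationClass hK (ContinuousLinearEquiv.neg 𝕜)
  convert h using 1
  ext x
  simp

theorem sub_mem_perturbationClass {K L : X →L[𝕜] Y}
    (hK : K ∈ perturbationClass (upperSemiFredholm 𝕜 X Y))
    (hL : L ∈ perturbationClass (upperSemiFredholm 𝕜 X Y)) :
    K - L ∈ perturbationClass (upperSemiFredholm 𝕜 X Y) :=
  sub_eq_add_neg K L ▸ add_mem_perturbationClass hK (neg_mem_perturbationClass hL)

theorem sub_mem_upperSemiFredholm {T K : X →L[𝕜] Y} (hT : T ∈ upperSemiFredholm 𝕜 X Y)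
    (hK : K ∈ perturbationClass (upperSemiFredholm 𝕜 X Y)) : T - K ∈ upperSemiFredholm 𝕜 X Y :=
  sub_eq_add_neg T K ▸ neg_mem_perturbationClass hK T hT

theorem finiteDimensional_of_eqOn_of_mem_perturbationClass {T K : X →L[𝕜] Y}
    (hT : T ∈ upperSemiFredholm 𝕜 X Y) (hK : K ∈ perturbationClass (upperSemiFredholm 𝕜 X Y))
    {M : Submodule 𝕜 X} (h : Set.EqOn T K M) : FiniteDimensional 𝕜 M := by
  have hker : M ≤ (T - K).ker := fun x hx => sub_eq_zero.2 (h hx)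
  have := (sub_mem_upperSemiFredholm hT hK).1
  exact Submodule.finiteDimensional_of_le hker

end PerturbationClass

section Subprojective

variable {𝕜 : Type*} [RCLike 𝕜]
  {X : Type*} [NormedAddCommGroup X] [NormedSpace 𝕜 X] [CompleteSpace X]
  {Y : Type*} [NormedAddCommGroup Y] [NormedSpace 𝕜 Y] [CompleteSpace Y]
  {Z : Type*} [NormedAddCommGroup Z] [NormedSpace 𝕜 Z] [CompleteSpace Z]
  {S K : X →L[𝕜] Y}

theorem finiteDimensional_of_isCompactOperator_comp_add_comp (hX : IsSubprojective 𝕜 X)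
    (hS : S ∈ upperSemiFredholm 𝕜 X Y) (hK : K ∈ perturbationClass (upperSemiFredholm 𝕜 X Y))
    {J W : Z →L[𝕜] X} (hW : IsClosedEmbedding W) (h : IsCompactOperator (K ∘L J + S ∘L W)) :
    FiniteDimensional 𝕜 Z := by
  by_contra hZ
  have hrange : ¬ FiniteDimensional 𝕜 W.range := fun hfin =>
    hZ (LinearEquiv.ofInjective W.toLinearMap hW.injective).symm.finiteDimensional
  obtain ⟨G, hGW, hG, q, hq⟩ := hX W.range hW.isClosed_range hrange
  let Q : X →L[𝕜] X := G.subtypeL ∘L q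
  let A : X →L[𝕜] Z := (W.equivRange hW.injective hW.isClosed_range).symm ∘L
    Q.codRestrict W.range fun x => hGW (q x).2
  have hWA (x : X) : W (A x) = Q x :=
    congrArg Subtype.val ((W.equivRange hW.injective hW.isClosed_range).apply_symm_apply _)
  have hSQ : S ∘L Q ∈ perturbationClass (upperSemiFredholm 𝕜 X Y) := by
    have hSQ_eq : S ∘L Q = (K ∘L J + S ∘L W) ∘L A - K ∘L (J ∘L A) := by
      ext x
      simp [hWA]
    rw [hSQ_eq]
    exact sub_mem_perturbationClass (strictlySingular_subset_perturbationClass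
      (isStrictlySingular_of_isCompactOperator (h.comp_clm A))) (comp_mem_perturbationClass hK _)
  have hSG : Set.EqOn S (S ∘L Q) G := fun x hx => by simp [Q, hq ⟨x, hx⟩]
  exact hG (finiteDimensional_of_eqOn_of_mem_perturbationClass hS hSQ hSG)

theorem isStrictlySingular_of_isCompactOperator_comp_add_comp (hX : IsSubprojective 𝕜 X)
    (hS : S ∈ upperSemiFredholm 𝕜 X Y) (hK : K ∈ perturbationClass (upperSemiFredholm 𝕜 X Y))
    {J V : Z →L[𝕜] X} (h : IsCompactOperator (K ∘L J + S ∘L V)) : IsStrictlySingular V := by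
  intro M hM hMinf hemb
  have : CompleteSpace M := hM.completeSpace_coe
  exact hMinf (finiteDimensional_of_isCompactOperator_comp_add_comp (J := J ∘L M.subtypeL) hX hS hK
    (isClosedEmbedding_of_isEmbedding hemb) (h.comp_clm M.subtypeL))

theorem perturbationClass_subset_strictlySingular (hne : (upperSemiFredholm 𝕜 X Y).Nonempty)
    (hX : IsSubprojective 𝕜 X) :
    perturbationClass (upperSemiFredholm 𝕜 X Y) ⊆ strictlySingular 𝕜 X Y := by
  intro K hK M hM hMinf hemb
  obtain ⟨S, hS⟩ := hne
  obtain ⟨N, hNM, hNinf, hN⟩ := hX M hM hMinf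
  have : CompleteSpace N := hN.isClosed.completeSpace_coe
  have hKN : IsClosedEmbedding (K ∘L N.subtypeL) :=
    isClosedEmbedding_of_isEmbedding (hemb.comp (.inclusion hNM))
  obtain ⟨p, hp⟩ := hN
  let P : X →L[𝕜] X := N.subtypeL ∘L p
  let V : X →L[𝕜] X := .id 𝕜 X - P
  let T : X →L[𝕜] Y := K ∘L P + S ∘L V
  have hTN : Set.EqOn T (K ∘L P) N := fun x hx => by simp [T, V, P, hp ⟨x, hx⟩]
  have hT : ¬ IsUpperSemiFredholm T := fun hT => hNinf
    (finiteDimensional_of_eqOn_of_mem_perturbationClass hT (comp_mem_perturbationClass hK P) hTN)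
  obtain ⟨L, hL, hLinf, hTL⟩ :=
    exists_isCompactOperator_comp_subtypeL_of_not_isUpperSemiFredholm hT
  have : CompleteSpace L := hL.completeSpace_coe
  have hVL : IsStrictlySingular (V ∘L L.subtypeL) :=
    isStrictlySingular_of_isCompactOperator_comp_add_comp (J := P ∘L L.subtypeL) hX hS hK hTL
  obtain ⟨E, hE, hEinf, hVE⟩ := hVL.exists_isCompactOperator_comp_subtypeL hLinf
  let ι : E →L[𝕜] X := L.subtypeL ∘L E.subtypeL
  have hι : IsClosedEmbedding ι :=
    hL.isClosedEmbedding_subtypeVal.comp hE.isClosedEmbedding_subtypeVal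
  have hKPE : IsCompactOperator (K ∘L P ∘L ι) := by
    have hKP : K ∘L P ∘L ι = T ∘L ι - S ∘L V ∘L ι := by
      ext x
      simp [T]
    exact hKP ▸ (hTL.comp_clm E.subtypeL).sub (hVE.clm_comp S)
  exact hEinf (finiteDimensional_of_isCompactOperator_comp_of_isCompactOperator_id_sub_comp
    hKN hι hKPE hVE)

end Subprojective

theorem theorem2 {𝕜 : Type*} [RCLike 𝕜]
    {X : Type*} [NormedAddCommGroup X] [NormedSpace 𝕜 X] [CompleteSpace X]
    {Y : Type*} [NormedAddCommGroup Y] [NormedSpace 𝕜 Y] [CompleteSpace Y]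
    (hne : (upperSemiFredholm 𝕜 X Y).Nonempty) (hX : IsSubprojective 𝕜 X) :
    perturbationClass (upperSemiFredholm 𝕜 X Y) = strictlySingular 𝕜 X Y :=
  (perturbationClass_subset_strictlySingular hne hX).antisymm
    strictlySingular_subset_perturbationClass
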